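/- For a probability space $(\Omega,\mathcal F,P)$ and an arbitrary (possibly nonmeasurable) function $f:\Omega\to\mathbb R$, let $f^*$ be the minimal measurable majorant of $f$: a measurable $[-\infty,\infty]$-valued function with $f\le f^*$ everywhere such that every measurable $[-\infty,\infty]$-valued $h$ with $f\le h$ everywhere satisfies $f^*\le h$ almost surely. Let $f_*$ be, dually, the maximal measurable minorant of $f$. Both exist and are unique up to almost sure equality. Put $E^*[f]=E[f^*]$ and $E_*[f]=E[f_*]$. For $H\subseteq\Omega$ let $P_*(H)=\sup\{P(A): A\in\mathcal F,\ A\subseteq H\}$ and $P^*(H)=\inf\{P(B): B\in\mathcal F,\ H\subseteq B\}$ be the inner and outer measures generated by $P$. Let $(\Omega_1,\mathcal F_1,P_1)$ be a probability space, let $(\Omega,\mathcal F,P)$ be the product of countably infinitely many copies of it, let $\Psi:\Omega_1\to\mathbb R$ be an arbitrary function, and let $X_n(\omega_1,\omega_2,\dots)=\Psi(\omega_n)$ and $S_n=X_1+\dots+X_n$ for $n\ge 1$. **Theorem.** Suppose $E^*[|X_1|]<\infty$. Let $a\in[E_*[X_1],E^*[X_1]]$, and let $\varepsilon>0$ be such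 that $[E_*[X_1],E^*[X_1]]$ is not a subset of $[a-\varepsilon,a+\varepsilon]$. Then, as $n\to\infty$, $$P_*\left(\left|\tfrac{S_n}{n}-a\right|>\varepsilon\right)\to 0\qquad\text{and}\qquad P^*\left(\left|\tfrac{S_n}{n}-a\right|>\varepsilon\right)\to 1 .$$ -/

import Mathlib

open MeasureTheory Filter Topology
open scoped ENNReal

/-- The inner measure generated by `P`: the supremum of `P A` over measurable `A ⊆ H`. -/
noncomputable def innerProb {Ω : Type*} [MeasurableSpace Ω] (P : Measure Ω) (H : Set Ω) : ℝ≥0∞ :=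
  ⨆ (A : Set Ω) (_ : MeasurableSet A) (_ : A ⊆ H), P A

/-- The outer measure generated by `P`: the infimum of `P B` over measurable `B ⊇ H`. -/
noncomputable def outerProb {Ω : Type*} [MeasurableSpace Ω] (P : Measure Ω) (H : Set Ω) : ℝ≥0∞ :=
  ⨅ (B : Set Ω) (_ : MeasurableSet B) (_ : H ⊆ B), P B

/-- `g` is a minimal measurable majorant of the arbitrary function `f`: it is measurable, `f ≤ g`
everywhere, and every measurable `h` with `f ≤ h` everywhere satisfies `g ≤ h` almost surely.
Extended real values are allowed, so that such a `g` exists for every `f`. -/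
structure IsMinMeasurableMajorant {Ω : Type*} [MeasurableSpace Ω] (P : Measure Ω)
    (f g : Ω → EReal) : Prop where
  measurable : Measurable g
  le : ∀ ω, f ω ≤ g ω
  ae_le : ∀ h : Ω → EReal, Measurable h → (∀ ω, f ω ≤ h ω) → ∀ᵐ ω ∂P, g ω ≤ h ω

/-- `g` is a maximal measurable minorant of the arbitrary function `f`: it is measurable, `g ≤ f`
everywhere, and every measurable `h` with `h ≤ f` everywhere satisfies `h ≤ g` almost surely. -/
structure IsMaxMeasurableMinorant {Ω : Type*} [MeasurableSpace Ω] (P : Measure Ω)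
    (f g : Ω → EReal) : Prop where
  measurable : Measurable g
  le : ∀ ω, g ω ≤ f ω
  le_ae : ∀ h : Ω → EReal, Measurable h → (∀ ω, h ω ≤ f ω) → ∀ᵐ ω ∂P, h ω ≤ g ω

theorem exists_isMinMeasurableMajorant {Ω : Type*} [MeasurableSpace Ω] (P : Measure Ω)
    [IsProbabilityMeasure P] (f : Ω → EReal) : ∃ g, IsMinMeasurableMajorant P f g := by
  classical
  let H : ℚ → Set Ω := fun q => toMeasurable P {ω | ((q : ℝ) : EReal) < f ω}
  have hH : ∀ q, MeasurableSet (H q) := fun q => measurableSet_toMeasurable _ _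
  refine ⟨fun ω => ⨆ q : ℚ, if ω ∈ H q then ((q : ℝ) : EReal) else ⊥, ?_, ?_, ?_⟩
  · exact Measurable.iSup fun q => Measurable.ite (hH q) measurable_const measurable_const
  · intro ω
    refine le_of_forall_lt fun c hc => ?_
    obtain ⟨q, hcq, hq⟩ := EReal.lt_iff_exists_rat_btwn.1 hc
    have hmem : ω ∈ H q := subset_toMeasurable P _ hq
    refine lt_of_lt_of_le hcq ?_
    refine le_trans ?_ (le_iSup (fun q : ℚ => if ω ∈ H q then ((q : ℝ) : EReal) else ⊥) q)
    simp [hmem]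
  · intro h hm hle
    have key : ∀ q : ℚ, ∀ᵐ ω ∂P, ω ∈ H q → ((q : ℝ) : EReal) < h ω := by
      intro q
      have hK : MeasurableSet {ω | ((q : ℝ) : EReal) < h ω} :=
        measurableSet_lt measurable_const hm
      have hsub : {ω | ((q : ℝ) : EReal) < f ω} ⊆ H q ∩ {ω | ((q : ℝ) : EReal) < h ω} :=
        fun ω hω => ⟨subset_toMeasurable P _ hω, lt_of_lt_of_le hω (hle ω)⟩
      have h1 : P (H q) ≤ P (H q ∩ {ω | ((q : ℝ) : EReal) < h ω}) :=
        (measure_toMeasurable _).le.trans (measure_mono hsub)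
      have h2 : P (H q \ {ω | ((q : ℝ) : EReal) < h ω}) = 0 := by
        have h3 := measure_inter_add_sdiff (μ := P) (H q) hK
        have h4 : P (H q ∩ {ω | ((q : ℝ) : EReal) < h ω}) +
            P (H q \ {ω | ((q : ℝ) : EReal) < h ω}) ≤
            P (H q ∩ {ω | ((q : ℝ) : EReal) < h ω}) + 0 := by
          rw [h3, add_zero]; exact h1
        exact le_antisymm ((ENNReal.add_le_add_iff_left (measure_ne_top _ _)).1 h4) bot_le
      rw [ae_iff]
      convert h2 using 2
      ext ω
      simp
    filter_upwards [ae_all_iff.2 key] with ω hω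
    refine iSup_le fun q => ?_
    split_ifs with hq
    · exact (hω q hq).le
    · exact bot_le

theorem exists_isMaxMeasurableMinorant {Ω : Type*} [MeasurableSpace Ω] (P : Measure Ω)
    [IsProbabilityMeasure P] (f : Ω → EReal) : ∃ g, IsMaxMeasurableMinorant P f g := by
  obtain ⟨g, hg⟩ := exists_isMinMeasurableMajorant P (fun ω => -f ω)
  refine ⟨fun ω => -g ω, hg.measurable.neg, fun ω => EReal.neg_le.1 (hg.le ω), ?_⟩
  intro h hm hle
  filter_upwards [hg.ae_le (fun ω => -h ω) hm.neg (fun ω => EReal.neg_le_neg_iff.2 (hle ω))]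
    with ω hω
  exact EReal.le_neg_of_le_neg hω

/-- The minimal measurable majorant `f^*` of `f` (unique up to almost sure equality). -/
noncomputable def minMeasurableMajorant {Ω : Type*} [MeasurableSpace Ω] (P : Measure Ω)
    [IsProbabilityMeasure P] (f : Ω → EReal) : Ω → EReal :=
  (exists_isMinMeasurableMajorant P f).choose

/-- The maximal measurable minorant `f_*` of `f` (unique up to almost sure equality). -/
noncomputable def maxMeasurableMinorant {Ω : Type*} [MeasurableSpace Ω] (P : Measure Ω)
    [IsProbabilityMeasure P] (f : Ω → EReal) : Ω → EReal :=
  (exists_isMaxMeasurableMinorant P f).choose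

/-- The expectation `E[g⁺] - E[g⁻]` of a measurable extended-real-valued function `g`
(meaningful when `E[g⁺]` and `E[g⁻]` are not both infinite). -/
noncomputable def erealExpectation {Ω : Type*} [MeasurableSpace Ω] (P : Measure Ω)
    (g : Ω → EReal) : EReal :=
  ((∫⁻ ω, (g ω).toENNReal ∂P : ℝ≥0∞) : EReal) - ((∫⁻ ω, (-g ω).toENNReal ∂P : ℝ≥0∞) : EReal)

/-- The upper expectation `E^*[f] = E[f^*]` of a possibly nonmeasurable real function. -/
noncomputable def upperExpectation {Ω : Type*} [MeasurableSpace Ω] (P : Measure Ω)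
    [IsProbabilityMeasure P] (f : Ω → ℝ) : EReal :=
  erealExpectation P (minMeasurableMajorant P (fun ω => (f ω : EReal)))

/-- The lower expectation `E_*[f] = E[f_*]` of a possibly nonmeasurable real function. -/
noncomputable def lowerExpectation {Ω : Type*} [MeasurableSpace Ω] (P : Measure Ω)
    [IsProbabilityMeasure P] (f : Ω → ℝ) : EReal :=
  erealExpectation P (maxMeasurableMinorant P (fun ω => (f ω : EReal)))

/-- Independent identically distributed possibly nonmeasurable random variables on a countable
power of `Ω₁`: for one arbitrary function `Ψ` on `Ω₁`, the `n`-th variable is `Ψ` applied to the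
`n`-th coordinate. The sequence is indexed from `0`. -/
def IsIidPossiblyNonmeasurable {Ω₁ : Type*} (X : ℕ → (ℕ → Ω₁) → ℝ) : Prop :=
  ∃ Ψ : Ω₁ → ℝ, ∀ n ω, X n ω = Ψ (ω n)

/-- The sum of the first `n` variables. -/
noncomputable def partialSum {Ω : Type*} (X : ℕ → Ω → ℝ) (n : ℕ) (ω : Ω) : ℝ :=
  ∑ i ∈ Finset.range n, X i ω

/-!
Write `G` and `H` for real versions of the minimal majorant and the maximal minorant of `Ψ` on `Ω₁`.
By minimality, `Ψ` is within `δ` of `G` on a set of full outer measure, and likewise for `H`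
(`exists_real_minMeasurableMajorant`). By Fubini, sets of full outer measure in different coordinates
cut out a set of full outer measure in the product (`infinitePi_forall_lt_mem_eq_one`). So, on a
set of full outer measure, finitely many `X i` follow `H` or `G` up to `δ`, according to any given
deterministic pattern. Let the first `⌊p n⌋` variables follow `H` and the others `G`: by the strong law of large
numbers the averages come near `p ∫ H + (1 - p) ∫ G` with outer probability tending to one, and this
is an arbitrary point of `[∫ H, ∫ G]` (`tendsto_measure_average_near`).

Applied to the point `a`, this says that the complement of the event has outer probability tending to
one, so its inner probability tends to zero. Applied to whichever of `∫ H`, `∫ G` lies at distance more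
than `ε` from `a`, it says that the event itself has outer probability tending to one. The upper and
lower expectations enter only through `upperExpectation_le_integral` and
`integral_le_lowerExpectation`, which compare them with `∫ G` and `∫ H`.
-/

/-! ### Sets of full outer measure in a product -/

/-- Prepending a coordinate to a sequence, as a map of the product. -/
def consSeq {Ω₁ : Type*} (z : Ω₁ × (ℕ → Ω₁)) : ℕ → Ω₁
  | 0 => z.1
  | i + 1 => z.2 i

theorem measurable_consSeq {Ω₁ : Type*} [MeasurableSpace Ω₁] :
    Measurable (consSeq (Ω₁ := Ω₁)) := by
  refine measurable_pi_iff.2 fun i => ?_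
  cases i with
  | zero => exact measurable_fst
  | succ i => exact (measurable_pi_apply i).comp measurable_snd

theorem measurePreserving_consSeq {Ω₁ : Type*} [MeasurableSpace Ω₁] (P₁ : Measure Ω₁)
    [IsProbabilityMeasure P₁] :
    MeasurePreserving consSeq (P₁.prod (Measure.infinitePi fun _ : ℕ => P₁))
      (Measure.infinitePi fun _ : ℕ => P₁) := by
  classical
  refine ⟨measurable_consSeq, Measure.eq_infinitePi _ fun s t ht => ?_⟩
  -- Enlarge `s` to an initial segment of `ℕ`, filling up with `univ`.
  let t' : ℕ → Set Ω₁ := fun i => if i ∈ s then t i else Set.univ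
  have ht' : ∀ i, MeasurableSet (t' i) := fun i => by
    dsimp only [t']; split_ifs; exacts [ht i, .univ]
  obtain ⟨N, hN⟩ : ∃ N, s ⊆ Finset.range (N + 1) :=
    ⟨s.sup id, fun i hi => Finset.mem_range.2 (Nat.lt_succ_of_le (Finset.le_sup (f := id) hi))⟩
  have hprod : ∏ i ∈ s, P₁ (t i) = ∏ i ∈ Finset.range (N + 1), P₁ (t' i) := by
    rw [← Finset.prod_subset hN fun i _ hi => by simp [t', hi]]
    exact Finset.prod_congr rfl fun i hi => by simp [t', hi]
  have hpre : consSeq ⁻¹' (Set.pi s t) =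
      t' 0 ×ˢ Set.pi (Finset.range N : Set ℕ) (fun i => t' (i + 1)) := by
    ext z
    simp only [Set.mem_preimage, Set.mem_pi, Finset.mem_coe, Set.mem_prod, Finset.mem_range]
    constructor
    · intro h
      refine ⟨?_, fun i _ => ?_⟩
      · dsimp only [t']; split_ifs with h0
        exacts [h 0 h0, trivial]
      · dsimp only [t']; split_ifs with h0
        exacts [h _ h0, trivial]
    · rintro ⟨h0, h1⟩ i hi
      cases i with
      | zero => simpa [t', hi, consSeq] using h0
      | succ i =>
        have := h1 i (by simpa using hN hi)
        simpa [t', hi, consSeq] using this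
  rw [Measure.map_apply measurable_consSeq (MeasurableSet.pi s.countable_toSet fun i _ => ht i),
    hpre, Measure.prod_prod, Measure.infinitePi_pi _ (fun i _ => ht' (i + 1)), hprod,
    Finset.prod_range_succ', mul_comm]

/-- Finitely many arbitrary sets of full outer measure, placed in different coordinates, cut out a
set of full outer measure in the product. The sets need not be measurable. -/
theorem infinitePi_forall_lt_mem_eq_one {Ω₁ : Type*} [MeasurableSpace Ω₁] (P₁ : Measure Ω₁)
    [IsProbabilityMeasure P₁] (n : ℕ) (T : ℕ → Set Ω₁) (hT : ∀ i, P₁ (T i) = 1) :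
    Measure.infinitePi (fun _ : ℕ => P₁) {ω | ∀ i < n, ω i ∈ T i} = 1 := by
  induction n generalizing T with
  | zero => simp
  | succ n ih =>
    set Q := Measure.infinitePi (fun _ : ℕ => P₁)
    set B := toMeasurable Q {ω | ∀ i < n + 1, ω i ∈ T i} with hB
    have hBm : MeasurableSet B := measurableSet_toMeasurable _ _
    have hCm : MeasurableSet (consSeq ⁻¹' B) := measurable_consSeq hBm
    have hsec : ∀ x ∈ T 0, Q (Prod.mk x ⁻¹' (consSeq ⁻¹' B)) = 1 := by
      intro x hx
      refine le_antisymm prob_le_one ?_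
      rw [← ih (fun i => T (i + 1)) fun i => hT _]
      refine measure_mono fun ω hω => subset_toMeasurable Q _ ?_
      intro i hi
      cases i with
      | zero => exact hx
      | succ i => exact hω i (by omega)
    have hmeas : Measurable fun x => Q (Prod.mk x ⁻¹' (consSeq ⁻¹' B)) :=
      measurable_measure_prodMk_left hCm
    have hae : ∀ᵐ x ∂P₁, Q (Prod.mk x ⁻¹' (consSeq ⁻¹' B)) = 1 := by
      refine (mem_ae_iff_prob_eq_one (hmeas (measurableSet_singleton 1))).2
        (le_antisymm prob_le_one ((hT 0).ge.trans (measure_mono hsec)))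
    rw [← measure_toMeasurable, ← hB, ← (measurePreserving_consSeq P₁).measure_preimage
      hBm.nullMeasurableSet, Measure.prod_apply hCm, lintegral_congr_ae hae]
    simp

/-! ### Majorants and expectations -/

/-- The majorant of `|Ψ (ω 0)|` may depend on all coordinates; freezing the coordinates other than the
first at suitable values leaves a dominating function on `Ω₁` with finite integral. -/
theorem exists_dominating_of_upperExpectation_lt_top {Ω₁ : Type*} [MeasurableSpace Ω₁]
    (P₁ : Measure Ω₁) [IsProbabilityMeasure P₁] (Ψ : Ω₁ → ℝ)
    (hint : upperExpectation (Measure.infinitePi fun _ : ℕ => P₁) (fun ω => |Ψ (ω 0)|) < ⊤) :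
    ∃ L : Ω₁ → EReal, Measurable L ∧ (∀ x, ((|Ψ x| : ℝ) : EReal) ≤ L x) ∧
      ∫⁻ x, (L x).toENNReal ∂P₁ ≠ ∞ := by
  set Q := Measure.infinitePi (fun _ : ℕ => P₁)
  rw [upperExpectation] at hint
  set m := minMeasurableMajorant Q (fun ω => ((|Ψ (ω 0)| : ℝ) : EReal))
  have hm : IsMinMeasurableMajorant Q (fun ω => ((|Ψ (ω 0)| : ℝ) : EReal)) m :=
    (exists_isMinMeasurableMajorant Q _).choose_spec
  have hm0 : ∀ ω, 0 ≤ m ω := fun ω =>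
    le_trans (by exact_mod_cast abs_nonneg (Ψ (ω 0))) (hm.le ω)
  have hneg : ∫⁻ ω, (-m ω).toENNReal ∂Q = 0 := by
    have : ∀ ω, (-m ω).toENNReal = 0 := fun ω =>
      EReal.toENNReal_of_nonpos (by simpa using hm0 ω)
    simp [this]
  have hfin : ∫⁻ ω, (m ω).toENNReal ∂Q ≠ ∞ := by
    intro h
    rw [erealExpectation, hneg, h] at hint
    simp at hint
  have hmeas : Measurable fun z : Ω₁ × (ℕ → Ω₁) => (m (consSeq z)).toENNReal :=
    (hm.measurable.comp measurable_consSeq).ereal_toENNReal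
  rw [← (measurePreserving_consSeq P₁).lintegral_comp hm.measurable.ereal_toENNReal,
    lintegral_prod_symm' _ hmeas] at hfin
  obtain ⟨ω, hω⟩ := (ae_lt_top hmeas.lintegral_prod_left' hfin).exists
  exact ⟨fun x => m (consSeq (x, ω)),
    hm.measurable.comp (measurable_consSeq.comp (measurable_id.prodMk measurable_const)),
    fun x => hm.le (consSeq (x, ω)), hω.ne⟩

/-- The minimal majorant of a dominated `Ψ` is almost surely an integrable real function, and `Ψ` comes
within any `δ` of it on a set of full outer measure. -/
theorem exists_real_minMeasurableMajorant {Ω₁ : Type*} [MeasurableSpace Ω₁] (P₁ : Measure Ω₁)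
    [IsProbabilityMeasure P₁] (Ψ : Ω₁ → ℝ) (L : Ω₁ → EReal) (hL : Measurable L)
    (hΨL : ∀ x, ((|Ψ x| : ℝ) : EReal) ≤ L x) (hfin : ∫⁻ x, (L x).toENNReal ∂P₁ ≠ ∞) :
    ∃ (g : Ω₁ → EReal) (G : Ω₁ → ℝ), IsMinMeasurableMajorant P₁ (fun x => (Ψ x : EReal)) g ∧
      Measurable G ∧ Integrable G P₁ ∧ (∀ᵐ x ∂P₁, g x = G x) ∧
      ∀ δ > 0, P₁ {x | |Ψ x - G x| < δ} = 1 := by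
  obtain ⟨g, hg⟩ := exists_isMinMeasurableMajorant P₁ (fun x => (Ψ x : EReal))
  have hΨL' : ∀ x, (Ψ x : EReal) ≤ L x := fun x =>
    le_trans (by exact_mod_cast le_abs_self _) (hΨL x)
  have hbot : ∀ x, g x ≠ ⊥ := fun x h => by
    have := hg.le x
    rw [h] at this
    simp at this
  have hLtop : ∀ᵐ x ∂P₁, L x ≠ ⊤ := by
    filter_upwards [ae_lt_top hL.ereal_toENNReal hfin] with x hx h
    simp [h] at hx
  have hgL : ∀ᵐ x ∂P₁, g x ≤ L x := hg.ae_le L hL hΨL'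
  have hgG : ∀ᵐ x ∂P₁, g x = ((g x).toReal : EReal) := by
    filter_upwards [hLtop, hgL] with x h1 h2
    exact (EReal.coe_toReal (fun h => h1 (top_le_iff.1 (h ▸ h2))) (hbot x)).symm
  have hGm : Measurable fun x => (g x).toReal := hg.measurable.ereal_toReal
  refine ⟨g, fun x => (g x).toReal, hg, hGm, ⟨hGm.aestronglyMeasurable, ?_⟩, hgG, ?_⟩
  · refine lt_of_le_of_lt (lintegral_mono_ae ?_) hfin.lt_top
    filter_upwards [hgL, hgG] with x h1 h2
    rw [Real.enorm_eq_ofReal_abs, ← EReal.real_coe_toENNReal]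
    refine EReal.toENNReal_le_toENNReal ?_
    rcases abs_cases (g x).toReal with ⟨h, -⟩ | ⟨h, -⟩
    · rw [h, ← h2]; exact h1
    · rw [h]
      refine le_trans ?_ (hΨL x)
      have h3 : ((Ψ x : ℝ) : EReal) ≤ ((g x).toReal : EReal) := h2 ▸ hg.le x
      have h4 := EReal.coe_le_coe_iff.1 h3
      exact EReal.coe_le_coe_iff.2 ((neg_le_neg h4).trans (neg_le_abs _))
  · intro δ hδ
    -- Off a measurable hull `B` of the set, lowering `g` by `δ` keeps it a majorant of `Ψ`,
    -- so minimality of `g` makes the complement of `B` null.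
    classical
    set B := toMeasurable P₁ {x | |Ψ x - (g x).toReal| < δ} with hB
    have hBm : MeasurableSet B := measurableSet_toMeasurable _ _
    have hgood : MeasurableSet {x | g x = ((g x).toReal : EReal)} :=
      measurableSet_eq_fun hg.measurable hGm.coe_real_ereal
    have hC : MeasurableSet (Bᶜ ∩ {x | g x = ((g x).toReal : EReal)}) := hBm.compl.inter hgood
    have key := hg.ae_le
      (fun x => if x ∈ Bᶜ ∩ {x | g x = ((g x).toReal : EReal)}
        then (((g x).toReal - δ : ℝ) : EReal) else g x)
      (Measurable.ite hC (hGm.sub_const δ).coe_real_ereal hg.measurable) ?_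
    · rw [← measure_toMeasurable, ← hB]
      refine (mem_ae_iff_prob_eq_one hBm).1 ?_
      filter_upwards [key, hgG] with x h1 h2
      by_contra hx
      rw [if_pos ⟨hx, h2⟩, h2] at h1
      have := EReal.coe_le_coe_iff.1 h1
      simp only [EReal.toReal_coe] at this
      linarith
    · intro x
      split_ifs with hx
      · have h1 : ¬ |Ψ x - (g x).toReal| < δ := fun h => hx.1 (subset_toMeasurable P₁ _ h)
        have h2 : ((Ψ x : ℝ) : EReal) ≤ ((g x).toReal : EReal) := hx.2 ▸ hg.le x
        have h3 := EReal.coe_le_coe_iff.1 h2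
        refine EReal.coe_le_coe_iff.2 ?_
        rw [abs_of_nonpos (by linarith)] at h1
        linarith
      · exact hg.le x

theorem erealExpectation_mono {Ω : Type*} [MeasurableSpace Ω] {P : Measure Ω} {f g : Ω → EReal}
    (h : ∀ᵐ ω ∂P, f ω ≤ g ω) : erealExpectation P f ≤ erealExpectation P g := by
  refine EReal.sub_le_sub ?_ ?_ <;> refine EReal.coe_ennreal_le_coe_ennreal_iff.2
    (lintegral_mono_ae ?_) <;> filter_upwards [h] with ω hω
  · exact EReal.toENNReal_le_toENNReal hω
  · exact EReal.toENNReal_le_toENNReal (EReal.neg_le_neg_iff.2 hω)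

theorem erealExpectation_coe {Ω : Type*} [MeasurableSpace Ω] {P : Measure Ω} {f : Ω → ℝ}
    (hf : Integrable f P) :
    erealExpectation P (fun ω => (f ω : EReal)) = ((∫ ω, f ω ∂P : ℝ) : EReal) := by
  have hneg : ∫⁻ ω, ENNReal.ofReal (-f ω) ∂P ≠ ∞ := hf.neg.lintegral_lt_top.ne
  rw [integral_eq_lintegral_pos_part_sub_lintegral_neg_part hf, erealExpectation, EReal.coe_sub,
    EReal.coe_ennreal_toReal hf.lintegral_lt_top.ne, EReal.coe_ennreal_toReal hneg]
  rfl

theorem integral_infinitePi_eval_zero {Ω₁ : Type*} [MeasurableSpace Ω₁] (P₁ : Measure Ω₁)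
    [IsProbabilityMeasure P₁] {G : Ω₁ → ℝ} (hGi : Integrable G P₁) :
    ∫ ω, G (ω 0) ∂Measure.infinitePi (fun _ : ℕ => P₁) = ∫ x, G x ∂P₁ := by
  have hmp := measurePreserving_eval_infinitePi (fun _ : ℕ => P₁) 0
  have h := integral_map (f := G) hmp.measurable.aemeasurable
    (hmp.map_eq.symm ▸ hGi.aestronglyMeasurable)
  rw [hmp.map_eq] at h
  exact h.symm

theorem upperExpectation_le_integral {Ω₁ : Type*} [MeasurableSpace Ω₁] (P₁ : Measure Ω₁)
    [IsProbabilityMeasure P₁] {Ψ G : Ω₁ → ℝ} {g : Ω₁ → EReal} (hg : Measurable g)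
    (hΨg : ∀ x, (Ψ x : EReal) ≤ g x) (hGi : Integrable G P₁) (hgG : ∀ᵐ x ∂P₁, g x ≤ G x) :
    upperExpectation (Measure.infinitePi fun _ : ℕ => P₁) (fun ω => Ψ (ω 0)) ≤
      ((∫ x, G x ∂P₁ : ℝ) : EReal) := by
  have hmp := measurePreserving_eval_infinitePi (fun _ : ℕ => P₁) 0
  set Q := Measure.infinitePi (fun _ : ℕ => P₁)
  have hm : IsMinMeasurableMajorant Q (fun ω => (Ψ (ω 0) : EReal))
    (minMeasurableMajorant Q (fun ω => (Ψ (ω 0) : EReal))) :=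
    (exists_isMinMeasurableMajorant Q _).choose_spec
  have hGc : Integrable (fun ω => G (ω 0)) Q := hmp.integrable_comp_of_integrable hGi
  rw [← integral_infinitePi_eval_zero P₁ hGi, ← erealExpectation_coe hGc]
  refine erealExpectation_mono ?_
  filter_upwards [hm.ae_le (fun ω => g (ω 0)) (hg.comp hmp.measurable) fun ω => hΨg (ω 0),
    hmp.quasiMeasurePreserving.ae hgG] with ω h1 h2
  exact h1.trans h2

theorem integral_le_lowerExpectation {Ω₁ : Type*} [MeasurableSpace Ω₁] (P₁ : Measure Ω₁)
    [IsProbabilityMeasure P₁] {Ψ G : Ω₁ → ℝ} {g : Ω₁ → EReal} (hg : Measurable g)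
    (hΨg : ∀ x, g x ≤ Ψ x) (hGi : Integrable G P₁) (hgG : ∀ᵐ x ∂P₁, G x ≤ g x) :
    ((∫ x, G x ∂P₁ : ℝ) : EReal) ≤
      lowerExpectation (Measure.infinitePi fun _ : ℕ => P₁) (fun ω => Ψ (ω 0)) := by
  have hmp := measurePreserving_eval_infinitePi (fun _ : ℕ => P₁) 0
  set Q := Measure.infinitePi (fun _ : ℕ => P₁)
  have hm : IsMaxMeasurableMinorant Q (fun ω => (Ψ (ω 0) : EReal))
    (maxMeasurableMinorant Q (fun ω => (Ψ (ω 0) : EReal))) :=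
    (exists_isMaxMeasurableMinorant Q _).choose_spec
  have hGc : Integrable (fun ω => G (ω 0)) Q := hmp.integrable_comp_of_integrable hGi
  rw [← integral_infinitePi_eval_zero P₁ hGi, ← erealExpectation_coe hGc]
  refine erealExpectation_mono ?_
  filter_upwards [hm.le_ae (fun ω => g (ω 0)) (hg.comp hmp.measurable) fun ω => hΨg (ω 0),
    hmp.quasiMeasurePreserving.ae hgG] with ω h1 h2
  exact h2.trans h1

/-! ### Laws of large numbers along a deterministic pattern -/

/-- The indices `k n` need not tend to infinity: where `k n` stays small, the factor `k n / n` is small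
and `d` is bounded. -/
theorem tendsto_comp_mul_div_zero {d : ℕ → ℝ} (hd : Tendsto d atTop (𝓝 0)) {k : ℕ → ℕ}
    (hk : ∀ n, k n ≤ n) : Tendsto (fun n => d (k n) * ((k n : ℝ) / n)) atTop (𝓝 0) := by
  obtain ⟨C, hC⟩ := (Metric.isBounded_range_of_tendsto d hd).exists_norm_le
  have hC' : ∀ m, |d m| ≤ C := fun m => hC _ (Set.mem_range_self m)
  have hC0 : 0 ≤ C := (abs_nonneg _).trans (hC' 0)
  rw [Metric.tendsto_atTop]
  intro ε hε
  obtain ⟨N, hN⟩ := Metric.tendsto_atTop.1 hd ε hε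
  obtain ⟨M, hM⟩ := exists_nat_gt (C * N / ε)
  refine ⟨M + 1, fun n hn => ?_⟩
  have hn0 : (0 : ℝ) < n := by exact_mod_cast (by omega : 0 < n)
  rw [Real.dist_eq, sub_zero, abs_mul, abs_of_nonneg (by positivity : (0 : ℝ) ≤ (k n : ℝ) / n)]
  have hr1 : (k n : ℝ) / n ≤ 1 := div_le_one_of_le₀ (by exact_mod_cast hk n) hn0.le
  rcases le_total N (k n) with h | h
  · have h1 := hN _ h
    rw [Real.dist_eq, sub_zero] at h1
    exact lt_of_le_of_lt (mul_le_of_le_one_right (abs_nonneg _) hr1) h1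
  · have hMn : (M : ℝ) ≤ n := by exact_mod_cast (by omega : M ≤ n)
    calc |d (k n)| * ((k n : ℝ) / n) ≤ C * ((N : ℝ) / n) := by
          gcongr
          exact hC' _
      _ < ε := by
          rw [← mul_div_assoc, div_lt_iff₀ hn0]
          rw [div_lt_iff₀ hε] at hM
          nlinarith

theorem tendsto_sum_range_comp_div {u : ℕ → ℝ} {x p : ℝ}
    (hu : Tendsto (fun n : ℕ => (∑ i ∈ Finset.range n, u i) / n) atTop (𝓝 x)) {k : ℕ → ℕ}
    (hk : ∀ n, k n ≤ n) (hp : Tendsto (fun n : ℕ => (k n : ℝ) / n) atTop (𝓝 p)) :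
    Tendsto (fun n : ℕ => (∑ i ∈ Finset.range (k n), u i) / n) atTop (𝓝 (p * x)) := by
  have h1 := tendsto_comp_mul_div_zero (by simpa using hu.sub_const x) hk
  have h2 := h1.add (hp.mul_const x)
  rw [zero_add] at h2
  refine h2.congr fun n => ?_
  rcases eq_or_ne (k n) 0 with h | h
  · simp [h]
  · have : (k n : ℝ) ≠ 0 := by exact_mod_cast h
    field_simp
    ring

/-- The strong law of large numbers for a measurable function of the coordinates. -/
theorem ae_tendsto_average_coordinates {Ω₁ : Type*} [MeasurableSpace Ω₁] (P₁ : Measure Ω₁)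
    [IsProbabilityMeasure P₁] {G : Ω₁ → ℝ} (hG : Measurable G) (hGi : Integrable G P₁) :
    ∀ᵐ ω ∂Measure.infinitePi (fun _ : ℕ => P₁),
      Tendsto (fun n : ℕ => (∑ i ∈ Finset.range n, G (ω i)) / n) atTop (𝓝 (∫ x, G x ∂P₁)) := by
  have hmp := measurePreserving_eval_infinitePi (fun _ : ℕ => P₁)
  have h := ProbabilityTheory.strong_law_ae_real
    (μ := Measure.infinitePi (fun _ : ℕ => P₁)) (fun i ω => G (ω i))
    ((hmp 0).integrable_comp_of_integrable hGi)
    (fun i j hij => (ProbabilityTheory.iIndepFun_infinitePi (P := fun _ : ℕ => P₁)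
      (X := fun _ => G) fun _ => hG).indepFun hij)
    (fun i => ⟨(hG.comp (measurable_pi_apply i)).aemeasurable,
      (hG.comp (measurable_pi_apply 0)).aemeasurable, by
        rw [← Function.comp_def G, ← Function.comp_def G]
        have h1 := Measure.map_map (μ := Measure.infinitePi (fun _ : ℕ => P₁)) hG (hmp i).measurable
        have h2 := Measure.map_map (μ := Measure.infinitePi (fun _ : ℕ => P₁)) hG (hmp 0).measurable
        rw [(hmp i).map_eq] at h1
        rw [(hmp 0).map_eq] at h2
        exact h1.symm.trans h2⟩)
  rwa [integral_infinitePi_eval_zero P₁ hGi] at h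

/-- Cesàro averages of a sequence that switches from `u` to `v` after a proportion `p` of its terms. -/
theorem tendsto_average_ite {u v : ℕ → ℝ} {x y p : ℝ}
    (hu : Tendsto (fun n : ℕ => (∑ i ∈ Finset.range n, u i) / n) atTop (𝓝 x))
    (hv : Tendsto (fun n : ℕ => (∑ i ∈ Finset.range n, v i) / n) atTop (𝓝 y)) {k : ℕ → ℕ}
    (hk : ∀ n, k n ≤ n) (hp : Tendsto (fun n : ℕ => (k n : ℝ) / n) atTop (𝓝 p)) :
    Tendsto (fun n : ℕ => (∑ i ∈ Finset.range n, if i < k n then u i else v i) / n) atTop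
      (𝓝 (p * x + (1 - p) * y)) := by
  have h := ((tendsto_sum_range_comp_div hu hk hp).add hv).sub
    (tendsto_sum_range_comp_div hv hk hp)
  rw [show p * x + (1 - p) * y = p * x + y - p * y by ring]
  refine h.congr fun n => ?_
  have hs : ∑ i ∈ Finset.range n, (if i < k n then u i else v i) =
      ∑ i ∈ Finset.range (k n), u i + ∑ i ∈ Finset.range n, v i
        - ∑ i ∈ Finset.range (k n), v i := by
    rw [← Finset.sum_range_add_sum_Ico _ (hk n), ← Finset.sum_range_add_sum_Ico v (hk n),
      Finset.sum_congr rfl fun i hi => if_pos (Finset.mem_range.1 hi),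
      Finset.sum_congr (s₁ := Finset.Ico _ _) rfl
        fun i hi => if_neg (not_lt.2 (Finset.mem_Ico.1 hi).1)]
    ring
  rw [hs, sub_div, add_div]

/-- Every mean `b` between `∫ H` and `∫ G` is approximated by the averages of `Ψ` with outer probability
tending to one, if both `H` and `G` are approximated by `Ψ` on sets of full outer measure. The value
`P A` of a measure at a nonmeasurable set `A` is its outer measure. -/
theorem tendsto_measure_average_near {Ω₁ : Type*} [MeasurableSpace Ω₁] (P₁ : Measure Ω₁)
    [IsProbabilityMeasure P₁] {Ψ H G : Ω₁ → ℝ} (hH : Measurable H) (hHi : Integrable H P₁)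
    (hHΨ : ∀ δ > 0, P₁ {x | |Ψ x - H x| < δ} = 1) (hG : Measurable G) (hGi : Integrable G P₁)
    (hGΨ : ∀ δ > 0, P₁ {x | |Ψ x - G x| < δ} = 1) {b δ : ℝ}
    (hb : b ∈ Set.Icc (∫ x, H x ∂P₁) (∫ x, G x ∂P₁)) (hδ : 0 < δ) :
    Tendsto (fun n : ℕ => Measure.infinitePi (fun _ : ℕ => P₁)
      {ω | |(∑ i ∈ Finset.range n, Ψ (ω i)) / n - b| < δ}) atTop (𝓝 1) := by
  set Q := Measure.infinitePi (fun _ : ℕ => P₁)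
  obtain ⟨p, q, hp, hq, hpq, rfl⟩ := (segment_eq_Icc (hb.1.trans hb.2)).symm ▸ hb
  obtain rfl : q = 1 - p := by linarith
  let k : ℕ → ℕ := fun n => ⌊p * n⌋₊
  have hk : ∀ n, k n ≤ n := fun n => Nat.floor_le_of_le (by
    have : (0 : ℝ) ≤ n := n.cast_nonneg
    nlinarith)
  have hkp : Tendsto (fun n : ℕ => (k n : ℝ) / n) atTop (𝓝 p) :=
    (tendsto_nat_floor_mul_div_atTop hp).comp tendsto_natCast_atTop_atTop
  -- The first `⌊p n⌋` coordinates are sent near `H`, the other ones near `G`.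
  let φ : ℕ → ℕ → Ω₁ → ℝ := fun n i x => if i < k n then H x else G x
  let A : ℕ → (ℕ → Ω₁) → ℝ := fun n ω => (∑ i ∈ Finset.range n, φ n i (ω i)) / n
  have hφm : ∀ n i, Measurable (φ n i) := fun n i => by
    dsimp only [φ]; split_ifs; exacts [hH, hG]
  have hAm : ∀ n, Measurable (A n) := fun n =>
    (Finset.measurable_sum _ fun i _ => (hφm n i).comp (measurable_pi_apply i)).div_const _
  have hconv : TendstoInMeasure Q A atTop
      fun _ => p • (∫ x, H x ∂P₁) + (1 - p) • ∫ x, G x ∂P₁ := by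
    refine tendstoInMeasure_of_tendsto_ae (fun n => (hAm n).aestronglyMeasurable) ?_
    filter_upwards [ae_tendsto_average_coordinates P₁ hH hHi,
      ae_tendsto_average_coordinates P₁ hG hGi] with ω h1 h2
    exact tendsto_average_ite h1 h2 hk hkp
  set b := p • (∫ x, H x ∂P₁) + (1 - p) • ∫ x, G x ∂P₁
  have hfar := tendstoInMeasure_iff_dist.1 hconv (δ / 2) (half_pos hδ)
  have hlow : Tendsto (fun n => 1 - Q {ω | δ / 2 ≤ dist (A n ω) b}) atTop (𝓝 1) := by
    simpa using ENNReal.Tendsto.sub tendsto_const_nhds hfar (Or.inl ENNReal.one_ne_top)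
  refine tendsto_of_tendsto_of_tendsto_of_le_of_le hlow tendsto_const_nhds (fun n => ?_)
    fun n => prob_le_one
  -- The coordinates follow the pattern `φ n` on a set `T` of full outer measure, and outer measure
  -- is not lost on intersecting `T` with the measurable event `M`.
  let M : Set (ℕ → Ω₁) := {ω | δ / 2 ≤ dist (A n ω) b}
  let T : Set (ℕ → Ω₁) := {ω | ∀ i < n, ω i ∈ {x | |Ψ x - φ n i x| < δ / 2}}
  have hM : MeasurableSet M := measurableSet_le measurable_const ((hAm n).dist measurable_const)
  have hT : Q T = 1 := infinitePi_forall_lt_mem_eq_one P₁ n _ fun i => by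
    dsimp only [φ]; split_ifs
    exacts [hHΨ _ (half_pos hδ), hGΨ _ (half_pos hδ)]
  have hTM : Q (T ∩ Mᶜ) = 1 - Q M := by
    rw [← Measure.measure_toMeasurable_inter hM.compl (measure_ne_top Q T), ← prob_compl_eq_one_sub hM]
    refine measure_congr ?_
    have : toMeasurable Q T ∈ ae Q := (mem_ae_iff_prob_eq_one (measurableSet_toMeasurable _ _)).2
      (by rw [measure_toMeasurable, hT])
    filter_upwards [this] with ω hω
    exact propext ⟨fun h => h.2, fun h => ⟨hω, h⟩⟩
  change 1 - Q M ≤ _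
  rw [← hTM]
  refine measure_mono ?_
  rintro ω ⟨hωT, hωM⟩
  have h1 : |A n ω - b| < δ / 2 := by simpa [M, Real.dist_eq] using hωM
  have h2 : |(∑ i ∈ Finset.range n, Ψ (ω i)) / n - A n ω| ≤ δ / 2 := by
    dsimp only [A]
    rw [← sub_div, ← Finset.sum_sub_distrib, abs_div, Nat.abs_cast]
    refine div_le_of_le_mul₀ n.cast_nonneg (half_pos hδ).le ?_
    refine (Finset.abs_sum_le_sum_abs _ _).trans ?_
    refine (Finset.sum_le_card_nsmul _ _ (δ / 2)
      fun i hi => (hωT i (Finset.mem_range.1 hi)).le).trans ?_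
    simp [mul_comm]
  have h3 := abs_sub_le ((∑ i ∈ Finset.range n, Ψ (ω i)) / n) (A n ω) b
  change |(∑ i ∈ Finset.range n, Ψ (ω i)) / n - b| < δ
  linarith

/-! ### Inner and outer probability -/

theorem outerProb_eq_measure {Ω : Type*} [MeasurableSpace Ω] (P : Measure Ω) (H : Set Ω) :
    outerProb P H = P H := by
  rw [measure_eq_iInf, outerProb]
  exact iInf_congr fun B => iInf_comm

theorem innerProb_le_one_sub {Ω : Type*} [MeasurableSpace Ω] (P : Measure Ω)
    [IsProbabilityMeasure P] (H : Set Ω) : innerProb P H ≤ 1 - P Hᶜ := by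
  refine iSup_le fun A => iSup_le fun hA => iSup_le fun hAH => ?_
  rw [← compl_compl A, prob_compl_eq_one_sub hA.compl]
  exact tsub_le_tsub_left (measure_mono (Set.compl_subset_compl.2 hAH)) 1

theorem theorem2 {Ω₁ : Type*} [MeasurableSpace Ω₁] (P₁ : Measure Ω₁) [IsProbabilityMeasure P₁]
    (P : Measure (ℕ → Ω₁)) [IsProbabilityMeasure P]
    (hP : P = Measure.infinitePi (fun _ : ℕ => P₁))
    (X : ℕ → (ℕ → Ω₁) → ℝ) (hX : IsIidPossiblyNonmeasurable X)
    (hint : upperExpectation P (fun ω => |X 0 ω|) < ⊤)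
    (a ε : ℝ)
    (ha : (a : EReal) ∈ Set.Icc (lowerExpectation P (X 0)) (upperExpectation P (X 0)))
    (hε : 0 < ε)
    (hsub : ¬ Set.Icc (lowerExpectation P (X 0)) (upperExpectation P (X 0)) ⊆
      Set.Icc ((a - ε : ℝ) : EReal) ((a + ε : ℝ) : EReal)) :
    Tendsto (fun n : ℕ => innerProb P {ω | ε < |partialSum X n ω / (n : ℝ) - a|}) atTop (𝓝 0) ∧
    Tendsto (fun n : ℕ => outerProb P {ω | ε < |partialSum X n ω / (n : ℝ) - a|}) atTop (𝓝 1) := by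
  subst hP
  obtain ⟨Ψ, hΨ⟩ := hX
  obtain rfl : X = fun n ω => Ψ (ω n) := funext fun n => funext fun ω => hΨ n ω
  clear hΨ
  obtain ⟨L, hL, hΨL, hfin⟩ := exists_dominating_of_upperExpectation_lt_top P₁ Ψ hint
  obtain ⟨g, G, hg, hG, hGi, hgG, hGΨ⟩ :=
    exists_real_minMeasurableMajorant P₁ Ψ L hL hΨL hfin
  obtain ⟨h, K, hh, hK, hKi, hhK, hKΨ⟩ :=
    exists_real_minMeasurableMajorant P₁ (fun x => -Ψ x) L hL (fun x => by simpa using hΨL x) hfin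
  -- The maximal minorant of `Ψ` is the negative of the minimal majorant of `-Ψ`.
  have hup := upperExpectation_le_integral P₁ hg.measurable hg.le hGi (hgG.mono fun _ => Eq.le)
  have hlow := integral_le_lowerExpectation P₁ (Ψ := Ψ) (g := fun x => -h x) hh.measurable.neg
    (fun x => EReal.neg_le.1 (by simpa using hh.le x)) hKi.neg
    (hhK.mono fun x hx => by simp [hx])
  have hKΨ' : ∀ δ > 0, P₁ {x | |Ψ x - (-K) x| < δ} = 1 := fun δ hδ => by
    rw [← hKΨ δ hδ]
    congr 1
    ext x
    simp only [Set.mem_ofPred_eq, Pi.neg_apply]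
    rw [← abs_neg, show -(Ψ x - -K x) = -Ψ x - K x by ring]
  have near := fun b δ (hb : b ∈ Set.Icc (∫ x, (-K) x ∂P₁) (∫ x, G x ∂P₁)) (hδ : 0 < δ) =>
    tendsto_measure_average_near P₁ hK.neg hKi.neg hKΨ' hG hGi hGΨ hb hδ
  have haI : a ∈ Set.Icc (∫ x, (-K) x ∂P₁) (∫ x, G x ∂P₁) :=
    ⟨EReal.coe_le_coe_iff.1 (hlow.trans ha.1), EReal.coe_le_coe_iff.1 (ha.2.trans hup)⟩
  simp only [partialSum]
  constructor
  · have h1 := ENNReal.Tendsto.sub tendsto_const_nhds (near a ε haI hε)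
      (Or.inl ENNReal.one_ne_top)
    rw [tsub_self] at h1
    refine tendsto_of_tendsto_of_tendsto_of_le_of_le tendsto_const_nhds h1 (fun _ => zero_le)
      fun n => (innerProb_le_one_sub _ _).trans (tsub_le_tsub_left (measure_mono ?_) 1)
    intro ω hω
    have h2 : |(∑ i ∈ Finset.range n, Ψ (ω i)) / n - a| < ε := hω
    exact not_lt.2 h2.le
  · simp only [outerProb_eq_measure]
    -- One of the two extreme means is farther than `ε` from `a`, and the averages come near it.
    obtain ⟨b, hb, hab⟩ : ∃ b ∈ Set.Icc (∫ x, (-K) x ∂P₁) (∫ x, G x ∂P₁), ε < |b - a| := by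
      by_contra! hcon
      have hK' := hcon _ ⟨le_rfl, haI.1.trans haI.2⟩
      have hG' := hcon _ ⟨haI.1.trans haI.2, le_rfl⟩
      refine hsub fun y hy => ⟨le_trans ?_ (hlow.trans hy.1), (hy.2.trans hup).trans ?_⟩
      · exact EReal.coe_le_coe_iff.2 (by linarith [(abs_le.1 hK').1])
      · exact EReal.coe_le_coe_iff.2 (by linarith [(abs_le.1 hG').2])
    refine tendsto_of_tendsto_of_tendsto_of_le_of_le (near b (|b - a| - ε) hb (by linarith))
      tendsto_const_nhds (fun n => measure_mono ?_) fun n => prob_le_one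
    intro ω hω
    have h3 := abs_sub_le b ((∑ i ∈ Finset.range n, Ψ (ω i)) / n) a
    rw [abs_sub_comm b (_ / _)] at h3
    have h4 : |(∑ i ∈ Finset.range n, Ψ (ω i)) / n - b| < |b - a| - ε := hω
    change ε < |(∑ i ∈ Finset.range n, Ψ (ω i)) / n - a|
    linarith
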